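/- All graphs are finite and simple. The \emph{order} of a graph is its number of vertices, its \emph{girth} is the length of a shortest cycle, it is \emph{cubic} if every vertex has degree $3$, and it is \emph{$3$-connected} if it has more than three vertices and deleting any set of at most two vertices leaves a connected graph. (i) For every integer $g\ge 3$ there exists a $3$-connected cubic graph whose order is divisible by $4$ and whose girth is at least $g$. (ii) Let $g\ge 4$ and let $B$ be any $3$-connected cubic graph of girth at least $g$ whose order is $\equiv 2 \pmod 4$. Let $u,v$ be adjacent vertices of $B$, let $a,b$ be the two neighbours of $u$ other than $v$, and let $c,d$ be the two neighbours of $v$ other than $u$. Take two disjoint copies $H$, $H'$ of $B-\{u,v\}$, writing $x'$ for the vertex of $H'$ corresponding to the vertex $x$ of $H$, and add the four edges $aa'$, $bb'$, $cd'$, $dc'$. The resulting graph is a $3$-connected cubic graph whose order is divisible by $4$ and whose girth is at least $g$. -/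

import Mathlib

namespace CubicGirth

variable {V : Type*}

/-- A graph is cubic if every vertex has degree exactly three. -/
def IsCubic (G : SimpleGraph V) : Prop :=
  ∃ _ : G.LocallyFinite, G.IsRegularOfDegree 3

/-- `k`-connectedness in the (vertex) sense: the graph has more than `k` vertices, and deleting
any set of fewer than `k` vertices leaves a connected graph. -/
def IsVertexConnected (G : SimpleGraph V) (k : ℕ) : Prop :=
  (k : ℕ∞) < ENat.card V ∧
    ∀ S : Finset V, S.card < k → (G.induce ((S : Set V)ᶜ)).Connected

/-- The graph obtained from two disjoint copies `H`, `H'` of `B - {u, v}` by adding the edges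
`aa'`, `bb'`, `cd'` and `dc'`, where `x'` in `H'` is the counterpart of `x` in `H`. -/
def gluedGraph (B : SimpleGraph V) (u v a b c d : V) :
    SimpleGraph ((({u, v} : Set V)ᶜ : Set V) ⊕ (({u, v} : Set V)ᶜ : Set V)) :=
  (B.induce (({u, v} : Set V)ᶜ) ⊕g B.induce (({u, v} : Set V)ᶜ)) ⊔
    SimpleGraph.fromRel (fun p q => ∃ x y, p = Sum.inl x ∧ q = Sum.inr y ∧
      (((x : V) = a ∧ (y : V) = a) ∨ ((x : V) = b ∧ (y : V) = b) ∨
        ((x : V) = c ∧ (y : V) = d) ∨ ((x : V) = d ∧ (y : V) = c)))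

end CubicGirth

/-! ### Cubic graphs, connectedness by closed sets, and cycles under locally injective maps -/

namespace CubicGirth
open SimpleGraph

/-! Large girth comes from iterating the mod-2 homology cover, starting at `K₄`. A cycle of the
cover projects to a non-backtracking closed walk that uses every edge an even number of times; this
walk contains a cycle of the base and runs through each of its edges at least twice, so the girth
bound doubles (`homologyCover.two_mul_le_egirth`). Cubicity lifts, and so does the absence of edge
cuts of size one or two, in the form `AdjJoined` (`homologyCover.adjJoined`). In a connected finite
cubic graph this gives 3-connectedness (`NoSmallCut.isVertexConnected`), so a component of the cover
serves.

A cubic graph has even order `n`, so gluing yields order `2(n - 2)`, a multiple of 4; hence the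
gluing construction of (ii) also finishes (i). A cycle of the glued graph inside one copy is a cycle
of `B`; one that crosses must travel between distinct attachment vertices in both copies, and these
are at distance at least `g - 3` (`IsGluingSite.le_egirth_gluedGraph`). For 3-connectedness, a
separation is recorded as two partitions of the same set `V`, one per copy. The hard case deletes
one vertex from each copy: the twist `cd'`, `dc'` makes the partitions cross, and an intersection of
their sides would then be cut off from `v` by two vertices of `B`
(`IsSeparation.false_of_crossing`). -/

theorem isCubic_iff_ncard {V : Type*} {G : SimpleGraph V} :
    IsCubic G ↔ ∀ v, (G.neighborSet v).ncard = 3 := by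
  constructor
  · rintro ⟨hf, h⟩ v
    rw [← h v, ← card_neighborSet_eq_degree, ← Nat.card_eq_fintype_card, Nat.card_coe_set_eq]
  · intro h
    let hf : G.LocallyFinite :=
      fun v => (Set.finite_of_ncard_ne_zero (by rw [h v]; norm_num)).fintype
    refine ⟨hf, fun v => ?_⟩
    rw [← card_neighborSet_eq_degree, ← Nat.card_eq_fintype_card, Nat.card_coe_set_eq]
    exact h v

theorem IsCubic.three_mul_card {V : Type*} [Fintype V] {G : SimpleGraph V} [Fintype G.edgeSet]
    (h : IsCubic G) : 3 * Fintype.card V = 2 * G.edgeFinset.card := by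
  classical
  obtain ⟨_, h⟩ := h
  have h1 := G.sum_degrees_eq_twice_card_edges
  refine .trans ?_ (h1.trans (by congr!))
  rw [Finset.sum_congr rfl (g := fun _ => 3) fun v _ => by convert h v]
  simp [mul_comm]

theorem IsCubic.even_card {V : Type*} [Finite V] {G : SimpleGraph V} (h : IsCubic G) :
    Even (Nat.card V) := by
  classical
  have := Fintype.ofFinite V
  have h1 := h.three_mul_card
  rw [Nat.card_eq_fintype_card, Nat.even_iff]
  omega

/-- A tree has `n - 1` edges, a cubic graph `3n/2`. This is needed because `girth` is `0` on
forests. -/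
theorem IsCubic.not_isAcyclic {V : Type*} [Finite V] {G : SimpleGraph V} (h : IsCubic G)
    (hc : G.Connected) : ¬ G.IsAcyclic := by
  classical
  intro ha
  have := Fintype.ofFinite V
  have h1 := h.three_mul_card
  have h3 := (IsTree.mk hc ha).card_edgeFinset
  have := hc.nonempty
  have := Fintype.card_pos (α := V)
  omega

theorem _root_.SimpleGraph.Walk.mem_of_closed {V : Type*} {G : SimpleGraph V} {D : Set V}
    (hD : ∀ x ∈ D, ∀ y, G.Adj x y → y ∈ D) {x y : V} (p : G.Walk x y) (hx : x ∈ D) : y ∈ D := by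
  induction p with
  | nil => exact hx
  | cons h p ih => exact ih (hD _ hx _ h)

/-- The cut form of connectedness, in which all the vertex-deletion arguments are carried out
without passing to subtypes. -/
theorem induce_connected_iff {V : Type*} {G : SimpleGraph V} {A : Set V} :
    (G.induce A).Connected ↔ A.Nonempty ∧ ∀ D ⊆ A, D.Nonempty →
      (∀ x ∈ D, ∀ y ∈ A, G.Adj x y → y ∈ D) → A ⊆ D := by
  constructor
  · intro h
    obtain ⟨x⟩ := h.nonempty
    refine ⟨⟨x, x.2⟩, fun D hDA ⟨y, hy⟩ hD z hz => ?_⟩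
    obtain ⟨p⟩ := h.preconnected ⟨y, hDA hy⟩ ⟨z, hz⟩
    exact p.mem_of_closed (D := {w : A | (w : V) ∈ D}) (fun (a : A) ha (b : A) hab => hD a ha b b.2 (by simpa using hab)) hy
  · rintro ⟨⟨x, hx⟩, h⟩
    have : Nonempty A := ⟨⟨x, hx⟩⟩
    refine ⟨fun y z => ?_⟩
    have key := h {w | ∃ hw : w ∈ A, (G.induce A).Reachable y ⟨w, hw⟩} (fun w hw => hw.1)
      ⟨y, y.2, .rfl⟩ (by
        rintro a ⟨ha, hr⟩ b hb hab
        exact ⟨hb, hr.trans (Adj.reachable (by simpa using hab))⟩)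
    exact (key z.2).2

/-- A cycle maps under a locally injective homomorphism to a closed walk whose edges contain a
cycle. -/
theorem exists_isCycle_of_map {V W : Type*} {G : SimpleGraph V} {G' : SimpleGraph W} (f : G →g G')
    (hf : ∀ x y z, G.Adj x y → G.Adj y z → f x = f z → x = z) {a : V} {w : G.Walk a a}
    (hw : w.IsCycle) :
    ∃ (b : W) (c : G'.Walk b b), c.IsCycle ∧ c.edges ⊆ (w.map f).edges := by
  classical
  have chain : ∀ {x y : V} (p : G.Walk x y), p.edges.IsChain (· ≠ ·) →
      (p.map f).edges.IsChain (· ≠ ·) := by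
    intro x y p
    induction p with
    | nil => simp
    | @cons x y z h p ih =>
      cases p with
      | nil => simp
      | @cons _ y' _ h' p =>
        simp only [Walk.map_cons, Walk.edges_cons, List.isChain_cons_cons] at ih ⊢
        refine fun hp => ⟨fun he => hp.1 ?_, ih hp.2⟩
        have hxz : f x = f y' := by
          simp only [Sym2.eq_iff] at he
          rcases he with ⟨h1, h2⟩ | ⟨h1, _⟩
          · exact absurd h1 (f.map_adj h).ne
          · exact h1
        rw [hf x y y' h h' hxz, Sym2.eq_swap]
  have hp := chain w (hw.edges_nodup.isChain)
  set p := w.map f with hpdef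
  let F : SimpleGraph W := SimpleGraph.fromEdgeSet {e | e ∈ p.edges}
  have hFG : F ≤ G' := by
    intro x y hxy
    rw [fromEdgeSet_adj] at hxy
    exact p.adj_of_mem_edges hxy.1
  have hpF : ∀ e ∈ p.edges, e ∈ F.edgeSet := by
    intro e he
    rw [edgeSet_fromEdgeSet]
    exact ⟨he, G'.not_isDiag_of_mem_edgeSet (p.edges_subset_edgeSet he)⟩
  -- In a forest a non-backtracking walk is a path, and a closed path has length zero.
  have hF : ¬ F.IsAcyclic := by
    intro hac
    have := (hac.isPath_iff_isChain (p.transfer F hpF)).2 (by rwa [Walk.edges_transfer])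
    have h0 : (p.transfer F hpF).length = 0 := by
      exact Walk.length_eq_zero_iff.2 (Walk.isPath_iff_nil.1 this)
    have h3 := hw.three_le_length
    rw [Walk.length_transfer, hpdef, Walk.length_map] at h0
    omega
  rw [IsAcyclic] at hF
  push Not at hF
  obtain ⟨b, c, hc⟩ := hF
  refine ⟨b, c.mapLe hFG, hc.mapLe hFG, fun e he => ?_⟩
  rw [Walk.edges_mapLe_eq_edges] at he
  have := c.edges_subset_edgeSet he
  rw [edgeSet_fromEdgeSet] at this
  exact this.1

end CubicGirth

/-! ### The mod-2 homology cover -/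

namespace CubicGirth
open SimpleGraph

section HomologyCover

theorem voltage_add_self {α : Type*} (x : α → ZMod 2) : x + x = 0 :=
  funext fun _ => CharTwo.add_self_eq_zero _

open scoped Classical in
/-- The mod-2 homology cover of `G`: the `ZMod 2`-valued functions on edges act as voltages. -/
def homologyCover {V : Type*} (G : SimpleGraph V) : SimpleGraph (V × (Sym2 V → ZMod 2)) where
  Adj p q := G.Adj p.1 q.1 ∧ q.2 = p.2 + Pi.single s(p.1, q.1) 1
  symm := ⟨fun p q h => ⟨h.1.symm, by
    rw [h.2, Sym2.eq_swap, add_assoc, voltage_add_self, add_zero]⟩⟩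
  loopless := ⟨fun p h => G.loopless.irrefl _ h.1⟩

open scoped Classical in
/-- The parity vector of the edges traversed by a walk. -/
noncomputable def edgeParity {V : Type*} {G : SimpleGraph V} {u v : V} (p : G.Walk u v) : Sym2 V → ZMod 2 :=
  fun e => (p.edges.count e : ZMod 2)

variable {V : Type*} {G : SimpleGraph V}

open scoped Classical in
theorem edgeParity_cons {u v w : V} (h : G.Adj u v) (p : G.Walk v w) :
    edgeParity (p.cons h) = Pi.single s(u, v) 1 + edgeParity p := by
  ext e
  by_cases he : s(u, v) = e
  · subst he
    simp [edgeParity, add_comm]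
  · simp [edgeParity, List.count_cons_of_ne he, Pi.single_eq_of_ne' he]

theorem edgeParity_apply_eq_zero {u v : V} {p : G.Walk u v} {e : Sym2 V} (h : e ∉ p.edges) :
    edgeParity p e = 0 := by
  classical
  simp [edgeParity, List.count_eq_zero_of_not_mem h]

/-- The covering projection. -/
def homologyCover.proj (G : SimpleGraph V) : homologyCover G →g G where
  toFun := Prod.fst
  map_rel' h := h.1

theorem homologyCover.proj_injOn_neighbors (x y z : V × (Sym2 V → ZMod 2))
    (hxy : (homologyCover G).Adj x y) (hyz : (homologyCover G).Adj y z)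
    (h : proj G x = proj G z) : x = z := by
  have hxy := hxy.symm
  refine Prod.ext h ?_
  change x.1 = z.1 at h
  rw [hxy.2, hyz.2, h]

theorem homologyCover.reachable_lift {u v : V} (p : G.Walk u v) (x : Sym2 V → ZMod 2) :
    (homologyCover G).Reachable (u, x) (v, x + edgeParity p) := by
  classical
  induction p generalizing x with
  | nil =>
    rw [show edgeParity (.nil : G.Walk _ _) = 0 by ext; simp [edgeParity], add_zero]
  | @cons u w v h p ih =>
    rw [edgeParity_cons, ← add_assoc]
    exact (Adj.reachable (⟨h, rfl⟩ : (homologyCover G).Adj (u, x) (w, x + _))).trans (ih _)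

theorem homologyCover.snd_eq {P Q : V × (Sym2 V → ZMod 2)} (p : (homologyCover G).Walk P Q) :
    Q.2 = P.2 + edgeParity (p.map (proj G)) := by
  classical
  induction p with
  | nil => ext; simp [edgeParity]
  | cons h p ih =>
    rw [Walk.map_cons, edgeParity_cons, ih, h.2, add_assoc]; rfl

/-- A closed walk upstairs has total voltage zero, so its projection has even multiplicity on every
edge. The cycle `c` inside the projection thus fits twice, as a multiset of edges. -/
theorem homologyCover.two_mul_le_egirth {g : ℕ} (hg : (g : ℕ∞) ≤ G.egirth) :
    ((2 * g : ℕ) : ℕ∞) ≤ (homologyCover G).egirth := by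
  classical
  rw [le_egirth] at hg ⊢
  intro a w hw
  obtain ⟨b, c, hc, hcw⟩ := exists_isCycle_of_map (proj G) proj_injOn_neighbors hw
  have h1 := hg b c hc
  have h2 : List.Subperm (c.edges ++ c.edges) (w.map (proj G)).edges := by
    rw [List.subperm_ext_iff]
    intro e he
    have he : e ∈ c.edges := by simpa using he
    have h3 := List.count_pos_iff.2 (hcw he)
    have h4 : edgeParity (w.map (proj G)) e = 0 := by
      have := congrFun (snd_eq w) e
      simpa using this
    rw [edgeParity, ZMod.natCast_eq_zero_iff] at h4
    rw [List.count_append, List.count_eq_one_of_mem hc.edges_nodup he]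
    exact Nat.le_of_dvd h3 (by convert h4)
  have h5 := h2.length_le
  simp only [List.length_append, Walk.length_edges, Walk.length_map] at h5
  rw [Nat.cast_le] at h1 ⊢
  omega

theorem homologyCover.isCubic (h : IsCubic G) : IsCubic (homologyCover G) := by
  classical
  rw [isCubic_iff_ncard] at h ⊢
  rintro ⟨v, x⟩
  have : (homologyCover G).neighborSet (v, x) =
      (fun w => (w, x + Pi.single s(v, w) 1)) '' G.neighborSet v := by
    ext ⟨w, y⟩
    constructor
    · rintro ⟨h1, h2⟩
      exact ⟨w, h1, Prod.ext rfl h2.symm⟩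
    · rintro ⟨w', h1, h2⟩
      obtain ⟨rfl, rfl⟩ := Prod.mk.inj h2
      exact ⟨h1, rfl⟩
  rw [this, Set.ncard_image_of_injective _ fun a b hab => (Prod.mk.inj hab).1, h]

/-- Adjacent vertices stay joined when their edge and one further edge are deleted. -/
def AdjJoined (G : SimpleGraph V) : Prop :=
  ∀ u v, G.Adj u v → ∀ f, (G.deleteEdges {s(u, v), f}).Reachable u v

theorem homologyCover.deleteEdges_le {T : Set (Sym2 V)} {T' : Set (Sym2 (V × (Sym2 V → ZMod 2)))}
    (h : ∀ e ∈ T', e.map Prod.fst ∈ T) :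
    homologyCover (G.deleteEdges T) ≤ (homologyCover G).deleteEdges T' := by
  intro p q hpq
  obtain ⟨h1, h2⟩ := hpq
  rw [deleteEdges_adj] at h1 ⊢
  exact ⟨⟨h1.1, h2⟩, fun h3 => h1.2 (h _ h3)⟩

/-- Lift a walk `p` from `u` to `v` avoiding `e` and the projection of `f`, cross back over another
lift of `e`, then lift `p` again. The two parities of `p` cancel and the voltage of `e` remains, so
the route ends at the right vertex. -/
theorem homologyCover.adjJoined (h : AdjJoined G) : AdjJoined (homologyCover G) := by
  classical
  rintro ⟨u, x⟩ ⟨v, y⟩ ⟨huv, hy⟩ f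
  dsimp only at huv hy
  subst hy
  set e := s(u, v) with he
  set f₀ := f.map Prod.fst with hf₀
  set T := ({e, f₀} : Set (Sym2 V)) with hT
  set T' : Set (Sym2 (V × (Sym2 V → ZMod 2))) := {s((u, x), (v, x + Pi.single e 1)), f} with hT'
  have hle : homologyCover (G.deleteEdges T) ≤ (homologyCover G).deleteEdges T' := by
    refine deleteEdges_le ?_
    rintro _ (rfl | rfl)
    · exact Or.inl rfl
    · exact Or.inr rfl
  have notMem : ∀ {f'} (p : (G.deleteEdges {e, f'}).Walk u v) e', e' = e ∨ e' = f' →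
      e' ∉ p.edges := by
    intro f' p e' he' hp
    have := p.edges_subset_edgeSet hp
    rw [edgeSet_deleteEdges] at this
    exact this.2 he'
  have key : ∃ p : (G.deleteEdges T).Walk u v,
      s((v, x + edgeParity p), (u, x + edgeParity p + Pi.single e 1)) ≠ f := by
    obtain ⟨p⟩ := h u v huv f₀
    -- The only danger is that the middle edge is `f`. Then `f` lies over `e`, so only `e` has to be
    -- avoided below, and there is a choice of `p`: a path through some edge `d` and a walk avoiding
    -- `d` differ in parity at `d`, so their middle edges differ and one is not `f`.
    by_cases hp : s((v, x + edgeParity p), (u, x + edgeParity p + Pi.single e 1)) = f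
    · have hfe : f₀ = e := by
        rw [hf₀, ← hp, he, Sym2.eq_swap]; rfl
      have hT' : T = {e} := by rw [hT, hfe, Set.pair_eq_singleton]
      obtain ⟨d, hd⟩ : ∃ d, d ∈ p.bypass.edges := by
        refine List.exists_mem_of_ne_nil _ fun h0 => huv.ne ?_
        exact Walk.eq_of_length_eq_zero (p := p.bypass) (by rw [← Walk.length_edges, h0]; rfl)
      have hd1 : edgeParity p.bypass d = 1 := by
        have := List.count_eq_one_of_mem p.bypass_isPath.isTrail.edges_nodup hd
        simp only [edgeParity]
        exact_mod_cast congrArg (Nat.cast (R := ZMod 2)) (by convert this)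
      obtain ⟨r⟩ := h u v huv d
      have hr : G.deleteEdges {e, d} ≤ G.deleteEdges T := by
        rw [hT']
        exact G.deleteEdges_anti (by simp)
      have hd0 : edgeParity (r.mapLe hr) d = 0 :=
        edgeParity_apply_eq_zero (by
          rw [Walk.edges_mapLe_eq_edges]; exact notMem r d (Or.inr rfl))
      by_contra! hne
      rcases Sym2.eq_iff.1 ((hne p.bypass).trans (hne (r.mapLe hr)).symm) with ⟨h1, -⟩ | ⟨h1, -⟩
      · have := congrFun (add_left_cancel (congrArg Prod.snd h1)) d
        rw [hd1, hd0] at this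
        exact one_ne_zero this
      · exact huv.ne (congrArg Prod.fst h1).symm
    · exact ⟨p, hp⟩
  obtain ⟨p, hp⟩ := key
  have r1 := (reachable_lift p x).mono hle
  have r2 : ((homologyCover G).deleteEdges T').Adj (v, x + edgeParity p)
      (u, x + edgeParity p + Pi.single e 1) := by
    rw [deleteEdges_adj]
    refine ⟨⟨huv.symm, by rw [he, Sym2.eq_swap]⟩, ?_⟩
    rintro (h1 | h1)
    · have h0 := edgeParity_apply_eq_zero (notMem p e (Or.inl rfl))
      rcases Sym2.eq_iff.1 h1 with ⟨h2, -⟩ | ⟨h2, -⟩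
      · exact huv.ne (congrArg Prod.fst h2).symm
      · have := congrFun (congrArg Prod.snd h2) e
        simp [h0] at this
    · exact hp h1
  have r3 := (reachable_lift p (x + edgeParity p + Pi.single e 1)).mono hle
  have r := r1.trans (r2.reachable.trans r3)
  convert r using 2
  rw [add_right_comm, add_assoc x, voltage_add_self, add_zero]

end HomologyCover
end CubicGirth

/-! ### Cubic 3-connected graphs of large girth -/

namespace CubicGirth
open SimpleGraph

theorem isCubic_completeGraph_four : IsCubic (⊤ : SimpleGraph (Fin 4)) := by
  rw [isCubic_iff_ncard]
  intro v
  rw [neighborSet_top, Set.ncard_compl]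
  simp

/-- The two remaining vertices give edge-disjoint detours of length two, and `f` blocks at most one.
-/
theorem adjJoined_completeGraph_four : AdjJoined (⊤ : SimpleGraph (Fin 4)) := by
  intro u v huv f
  have key : ∀ u v : Fin 4, u ≠ v → ∃ w₁ w₂, w₁ ≠ w₂ ∧ w₁ ≠ u ∧ w₁ ≠ v ∧ w₂ ≠ u ∧ w₂ ≠ v := by
    decide
  obtain ⟨w₁, w₂, h12, h1u, h1v, h2u, h2v⟩ := key u v huv
  have hw : ∀ w, w ≠ u → w ≠ v → f ≠ s(u, w) → f ≠ s(w, v) →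
      ((⊤ : SimpleGraph (Fin 4)).deleteEdges {s(u, v), f}).Reachable u v := by
    intro w hu hv h1 h2
    have a1 : ((⊤ : SimpleGraph (Fin 4)).deleteEdges {s(u, v), f}).Adj u w := by
      rw [deleteEdges_adj]
      refine ⟨hu.symm, ?_⟩
      rintro (h | h)
      · exact hv (by simpa [hu] using h)
      · exact h1 h.symm
    have a2 : ((⊤ : SimpleGraph (Fin 4)).deleteEdges {s(u, v), f}).Adj w v := by
      rw [deleteEdges_adj]
      refine ⟨hv, ?_⟩
      rintro (h | h)
      · exact hu (by simpa [hv] using h)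
      · exact h2 h.symm
    exact a1.reachable.trans a2.reachable
  by_cases h : f = s(u, w₁) ∨ f = s(w₁, v)
  · refine hw w₂ h2u h2v ?_ ?_ <;> rcases h with rfl | rfl <;> simp <;> tauto
  · push Not at h
    exact hw w₁ h1u h1v h.1 h.2

theorem exists_cubic_adjJoined_le_egirth (g : ℕ) :
    ∃ (V : Type) (_ : Finite V) (_ : Nonempty V) (G : SimpleGraph V),
      IsCubic G ∧ AdjJoined G ∧ ((g + 3 : ℕ) : ℕ∞) ≤ G.egirth := by
  induction g with
  | zero =>
    exact ⟨Fin 4, inferInstance, inferInstance, ⊤, isCubic_completeGraph_four,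
      adjJoined_completeGraph_four, three_le_egirth⟩
  | succ g ih =>
    obtain ⟨V, _, _, G, h1, h2, h3⟩ := ih
    refine ⟨_, inferInstance, inferInstance, homologyCover G, homologyCover.isCubic h1,
      homologyCover.adjJoined h2, le_trans ?_ (homologyCover.two_mul_le_egirth h3)⟩
    rw [Nat.cast_le]
    omega

variable {V : Type*} {G : SimpleGraph V}

/-- No nonempty edge cut is contained in a set of two edges. -/
def NoSmallCut (G : SimpleGraph V) : Prop :=
  ∀ (X : Set V) (e f : Sym2 V), (∀ x ∈ X, ∀ y ∉ X, G.Adj x y → s(x, y) = e ∨ s(x, y) = f) →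
    ∀ x ∈ X, ∀ y ∉ X, ¬ G.Adj x y

theorem AdjJoined.noSmallCut (h : AdjJoined G) : NoSmallCut G := by
  intro X e f hX x hx y hy hxy
  obtain ⟨f', hf'⟩ : ∃ f', ∀ a ∈ X, ∀ b ∉ X, G.Adj a b → s(a, b) = s(x, y) ∨ s(a, b) = f' := by
    rcases hX x hx y hy hxy with rfl | rfl
    · exact ⟨f, hX⟩
    · exact ⟨e, fun a ha b hb hab => (hX a ha b hb hab).symm⟩
  obtain ⟨p⟩ := h x y hxy f'
  refine hy (p.mem_of_closed (fun a ha b hab => ?_) hx)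
  rw [deleteEdges_adj] at hab
  by_contra hb
  exact hab.2 (hf' a ha b hb hab.1)

theorem NoSmallCut.induce (h : NoSmallCut G) {C : Set V} (hC : ∀ x ∈ C, ∀ y, G.Adj x y → y ∈ C) :
    NoSmallCut (G.induce C) := by
  intro X e f hX x hx y hy hxy
  refine h (Subtype.val '' X) (e.map Subtype.val) (f.map Subtype.val) ?_ x ⟨x, hx, rfl⟩ y ?_ hxy
  · rintro _ ⟨a, ha, rfl⟩ b hb hab
    have hbX : (⟨b, hC a a.2 b hab⟩ : C) ∉ X := fun hh => hb ⟨_, hh, rfl⟩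
    rcases hX a ha _ hbX hab with h1 | h1
    · left; rw [← h1]; rfl
    · right; rw [← h1]; rfl
  · rintro ⟨y', hy', h1⟩
    exact hy (Subtype.ext h1 ▸ hy')

theorem IsCubic.induce (h : IsCubic G) {C : Set V} (hC : ∀ x ∈ C, ∀ y, G.Adj x y → y ∈ C) :
    IsCubic (G.induce C) := by
  rw [isCubic_iff_ncard] at h ⊢
  intro v
  rw [← h v, ← Set.ncard_image_of_injective _ Subtype.val_injective]
  congr 1
  ext w
  constructor
  · rintro ⟨w, hw, rfl⟩
    exact hw
  · intro hw
    exact ⟨⟨w, hC v v.2 w hw⟩, hw, rfl⟩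

theorem IsCubic.four_le_card [Finite V] [Nonempty V] (h : IsCubic G) : 4 ≤ Nat.card V := by
  rw [isCubic_iff_ncard] at h
  obtain ⟨v⟩ := ‹Nonempty V›
  have h1 : (insert v (G.neighborSet v)).ncard = 4 := by
    rw [Set.ncard_insert_of_notMem (by simp), h v]
  rw [← h1]
  exact Set.ncard_le_card _

theorem exists_pair_of_card_lt_three {α : Type*} [Nonempty α] {S : Finset α} (h : S.card < 3) :
    ∃ p q, ∀ s ∈ S, s = p ∨ s = q := by
  classical
  obtain ⟨a⟩ := ‹Nonempty α›
  have : S.card = 0 ∨ S.card = 1 ∨ S.card = 2 := by omega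
  rcases this with h | h | h
  · rw [Finset.card_eq_zero] at h
    exact ⟨a, a, by simp [h]⟩
  · obtain ⟨p, rfl⟩ := Finset.card_eq_one.1 h
    exact ⟨p, p, by simp⟩
  · obtain ⟨p, q, -, rfl⟩ := Finset.card_eq_two.1 h
    exact ⟨p, q, by simp⟩

/-- With degree 3, each deleted vertex can be put on the side holding the majority of its
neighbours, and then accounts for at most one cut edge. A separating set of at most two vertices
thus becomes a cut of at most two edges. -/
theorem NoSmallCut.isVertexConnected [Finite V] (h : NoSmallCut G) (hcub : IsCubic G)
    (hconn : G.Connected) : IsVertexConnected G 3 := by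
  have := hconn.nonempty
  have hcard := hcub.four_le_card
  rw [isCubic_iff_ncard] at hcub
  refine ⟨?_, fun S hS => ?_⟩
  · rw [ENat.card_eq_coe_natCard]
    exact_mod_cast hcard
  rw [induce_connected_iff]
  constructor
  · rw [Set.nonempty_compl]
    intro hu
    have : (S : Set V).ncard = Nat.card V := by rw [hu, Set.ncard_univ]
    rw [Set.ncard_coe_finset] at this
    omega
  intro D hDS ⟨d, hd⟩ hD
  by_contra hcon
  obtain ⟨b, hbS, hbD⟩ := Set.not_subset.1 hcon
  set X : Set V := D ∪ {s | s ∈ S ∧ 2 ≤ (G.neighborSet s ∩ D).ncard} with hX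
  have hle1 : ∀ T : Set V, T.ncard ≤ 1 → ∃ a, T ⊆ {a} := fun T hT =>
    (Set.ncard_le_one_iff_subset_singleton).1 hT
  have he : ∀ s, ∃ e, s ∈ S → (s ∈ X → ∀ y ∉ X, G.Adj s y → s(s, y) = e) ∧
      (s ∉ X → ∀ x ∈ D, G.Adj x s → s(x, s) = e) := by
    intro s
    by_cases hsX : s ∈ X
    · by_cases hsS : s ∈ S
      · have h2 : 2 ≤ (G.neighborSet s ∩ D).ncard := by
          rcases hsX with h1 | h1
          · exact absurd hsS (hDS h1)
          · exact h1.2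
        have h3 : (G.neighborSet s \ X).ncard ≤ 1 := by
          have h4 := Set.ncard_inter_add_ncard_sdiff_eq_ncard (G.neighborSet s) X
          have h5 : (G.neighborSet s ∩ D).ncard ≤ (G.neighborSet s ∩ X).ncard :=
            Set.ncard_le_ncard (Set.inter_subset_inter_right _ Set.subset_union_left)
          rw [hcub s] at h4
          omega
        obtain ⟨a, ha⟩ := hle1 _ h3
        exact ⟨s(s, a), fun _ => ⟨fun _ y hy hsy => by rw [ha ⟨hsy, hy⟩], fun h => absurd hsX h⟩⟩
      · exact ⟨s(s, s), fun h => absurd h hsS⟩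
    · by_cases hsS : s ∈ S
      · have h2 : (G.neighborSet s ∩ D).ncard ≤ 1 := by
          by_contra h1
          exact hsX (Or.inr ⟨hsS, by omega⟩)
        obtain ⟨a, ha⟩ := hle1 _ h2
        exact ⟨s(a, s), fun _ => ⟨fun h => absurd h hsX, fun _ x hx hxs => by
          rw [ha ⟨hxs.symm, hx⟩]⟩⟩
      · exact ⟨s(s, s), fun h => absurd h hsS⟩
  choose e he using he
  -- `e s` is the one cut edge charged to `s`; every cut edge has an end in `S`, since `D` is closed
  -- outside `S`.
  obtain ⟨p, q, hpq⟩ := exists_pair_of_card_lt_three hS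
  have hcut : ∀ x ∈ X, ∀ y ∉ X, ¬ G.Adj x y := by
    refine h X (e p) (e q) fun x hx y hy hxy => ?_
    obtain ⟨s, hs, hse⟩ : ∃ s ∈ S, s(x, y) = e s := by
      by_cases hxS : x ∈ S
      · exact ⟨x, hxS, (he x hxS).1 hx y hy hxy⟩
      · have hxD : x ∈ D := hx.resolve_right fun h => hxS h.1
        by_cases hyS : y ∈ S
        · exact ⟨y, hyS, (he y hyS).2 hy x hxD hxy⟩
        · exact absurd (Or.inl (hD x hxD y hyS hxy)) hy
    rcases hpq s hs with rfl | rfl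
    · exact Or.inl hse
    · exact Or.inr hse
  obtain ⟨w⟩ := hconn.preconnected d b
  have : b ∈ X := w.mem_of_closed
    (fun x hx y hxy => by_contra fun hy => hcut x hx y hy hxy) (Or.inl hd)
  rcases this with h1 | h1
  · exact hbD h1
  · exact hbS h1.1

theorem le_girth_of_le_egirth {g : ℕ} (h : (g : ℕ∞) ≤ G.egirth) (hG : ¬ G.IsAcyclic) :
    g ≤ G.girth := by
  rw [girth, ← ENat.natCast_le_natCast, ENat.natCast_toNat (by rwa [ne_eq, egirth_eq_top])]
  exact h
-- The iterated cover need not be connected. A component is closed under adjacency, so it inherits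
-- the degrees, the absence of small cuts and the girth bound.
theorem exists_cubic_isVertexConnected_three (g : ℕ) :
    ∃ (V : Type) (_ : Finite V) (G : SimpleGraph V),
      IsCubic G ∧ IsVertexConnected G 3 ∧ g ≤ G.girth := by
  obtain ⟨V, _, ⟨v⟩, G, h1, h2, h3⟩ := exists_cubic_adjJoined_le_egirth g
  let C := G.connectedComponentMk v
  have hC : ∀ x ∈ C.supp, ∀ y, G.Adj x y → y ∈ C.supp :=
    fun x hx y hxy => C.mem_supp_of_adj_mem_supp hx hxy
  have hconn : (G.induce C.supp).Connected := C.connected_toSimpleGraph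
  have hcub := h1.induce hC
  refine ⟨C.supp, inferInstance, G.induce C.supp, hcub,
    (h2.noSmallCut.induce hC).isVertexConnected hcub hconn, ?_⟩
  have h4 : ((g + 3 : ℕ) : ℕ∞) ≤ (G.induce C.supp).egirth :=
    h3.trans (IsContained.egirth_le ⟨(Embedding.induce C.supp).toCopy⟩)
  exact le_trans (by omega) (le_girth_of_le_egirth h4 (hcub.not_isAcyclic hconn))


end CubicGirth

/-! ### The gluing site and the degrees of the glued graph -/

namespace CubicGirth
open SimpleGraph

variable {V : Type*} {B : SimpleGraph V} {u v a b c d : V} {g : ℕ}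

theorem le_length_add_two {r x y : V} (hg : (g : ℕ∞) ≤ B.egirth) {p : B.Walk x y} (hp : p.IsPath)
    (hxy : x ≠ y) (hr : r ∉ p.support) (hx : B.Adj r x) (hy : B.Adj r y) : g ≤ p.length + 2 := by
  have hc : ((p.concat hy.symm).cons hx).IsCycle := by
    rw [Walk.cons_isCycle_iff]
    refine ⟨hp.concat hr _, ?_⟩
    rw [Walk.edges_concat, List.concat_eq_append, List.mem_append]
    rintro (h | h)
    · exact hr (p.fst_mem_support_of_mem_edges h)
    · rcases Sym2.eq_iff.1 (List.mem_singleton.1 h) with ⟨-, h⟩ | ⟨-, h⟩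
      · exact hx.ne h.symm
      · exact hxy h
  have := le_egirth.1 hg _ _ hc
  rw [Walk.length_cons, Walk.length_concat, Nat.cast_le] at this
  omega

theorem le_length_add_three_of_adj {x y : V} (hg : (g : ℕ∞) ≤ B.egirth) (huv : B.Adj u v)
    {p : B.Walk x y} (hp : p.IsPath) (hu : u ∉ p.support) (hv : v ∉ p.support)
    (hx : B.Adj u x) (hy : B.Adj v y) : g ≤ p.length + 3 := by
  have := le_length_add_two hg (hp.concat hv hy.symm) (fun h => hv (h ▸ p.start_mem_support))
    (r := u) (by simp [Walk.support_concat, hu, huv.ne]) hx huv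
  rwa [Walk.length_concat] at this

/-- Two distinct vertices attached to the edge `uv` are far apart once `u` and `v` are deleted. -/
theorem le_length_add_three {x y : V} (hg : (g : ℕ∞) ≤ B.egirth) (huv : B.Adj u v)
    {p : B.Walk x y} (hp : p.IsPath) (hxy : x ≠ y) (hu : u ∉ p.support) (hv : v ∉ p.support)
    (hx : B.Adj u x ∨ B.Adj v x) (hy : B.Adj u y ∨ B.Adj v y) : g ≤ p.length + 3 := by
  rcases hx with hx | hx <;> rcases hy with hy | hy
  · exact (le_length_add_two hg hp hxy hu hx hy).trans (by omega)
  · exact le_length_add_three_of_adj hg huv hp hu hv hx hy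
  · exact le_length_add_three_of_adj hg huv.symm hp hv hu hx hy
  · exact (le_length_add_two hg hp hxy hv hx hy).trans (by omega)

/-- The adjacent vertices `u`, `v` have no common neighbour; `a`, `b` are the other neighbours of
`u` and `c`, `d` the other neighbours of `v`. -/
structure IsGluingSite (B : SimpleGraph V) (u v a b c d : V) : Prop where
  adj : B.Adj u v
  adj_left : ∀ x, B.Adj u x ↔ x = v ∨ x = a ∨ x = b
  adj_right : ∀ x, B.Adj v x ↔ x = u ∨ x = c ∨ x = d
  no_common : ∀ x, B.Adj u x → ¬ B.Adj v x
  ne_left : a ≠ b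
  ne_right : c ≠ d
  c_ne : c ≠ u
  d_ne : d ≠ u

theorem ncard_triple_ne {x y z : V} (h : ({x, y, z} : Set V).ncard = 3) :
    y ≠ x ∧ z ≠ x ∧ y ≠ z := by
  have key : ∀ p q : V, ({p, q} : Set V).ncard ≤ 2 := fun p q => by
    have := Set.ncard_insert_le p {q}
    rwa [Set.ncard_singleton] at this
  refine ⟨?_, ?_, ?_⟩ <;> rintro rfl
  · rw [Set.insert_eq_of_mem (by simp)] at h
    have := key y z; omega
  · rw [Set.insert_eq_of_mem (by simp)] at h
    have := key y z; omega
  · rw [Set.insert_eq_of_mem (s := {y}) (by simp)] at h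
    have := key x y; omega

theorem IsGluingSite.of_isCubic (hB : IsCubic B) (hg : (4 : ℕ) ≤ B.egirth) (huv : B.Adj u v)
    (hu : B.neighborSet u = {v, a, b}) (hv : B.neighborSet v = {u, c, d}) :
    IsGluingSite B u v a b c d := by
  rw [isCubic_iff_ncard] at hB
  obtain ⟨-, -, h3⟩ := ncard_triple_ne (hu ▸ hB u)
  obtain ⟨h4, h5, h6⟩ := ncard_triple_ne (hv ▸ hB v)
  refine ⟨huv, fun x => ?_, fun x => ?_, fun x hx hx' => ?_, h3, h6, h4, h5⟩
  · rw [← mem_neighborSet, hu]; simp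
  · rw [← mem_neighborSet, hv]; simp
  -- A common neighbour would close a triangle, giving `4 ≤ 3`.
  · have := le_length_add_two hg (r := u) (p := .cons hx'.symm .nil) (by simp [hx'.ne']) hx'.ne'
      (by simp [huv.ne, hx.ne]) hx huv
    simp at this

/-- The relation matching attachment vertices of the two copies in `gluedGraph`. -/
def Partner (a b c d x y : V) : Prop :=
  (x = a ∧ y = a) ∨ (x = b ∧ y = b) ∨ (x = c ∧ y = d) ∨ (x = d ∧ y = c)

theorem Partner.symm {x y : V} (h : Partner a b c d x y) : Partner a b c d y x := by
  unfold Partner at *; tauto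

namespace IsGluingSite

theorem adj_of_partner (h : IsGluingSite B u v a b c d) {x y : V} (hp : Partner a b c d x y) :
    (B.Adj u x ∧ B.Adj u y) ∨ (B.Adj v x ∧ B.Adj v y) := by
  rw [h.adj_left, h.adj_left, h.adj_right, h.adj_right]
  unfold Partner at hp
  tauto

theorem exists_partner_left (h : IsGluingSite B u v a b c d) {x : V} (hx : B.Adj u x)
    (hxv : x ≠ v) : ∃ y, Partner a b c d x y ∧ B.Adj u y ∧ y ≠ v := by
  refine ⟨x, ?_, hx, hxv⟩
  rw [h.adj_left] at hx
  unfold Partner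
  tauto

theorem exists_partner_right (h : IsGluingSite B u v a b c d) {x : V} (hx : B.Adj v x)
    (hxu : x ≠ u) : ∃ y, Partner a b c d x y ∧ B.Adj v y ∧ y ≠ u := by
  rw [h.adj_right] at hx
  rcases hx with rfl | rfl | rfl
  · exact absurd rfl hxu
  · exact ⟨d, by simp [Partner], by simp [h.adj_right], h.d_ne⟩
  · exact ⟨c, by simp [Partner], by simp [h.adj_right], h.c_ne⟩

theorem partner_unique (h : IsGluingSite B u v a b c d) {x y y' : V} (hp : Partner a b c d x y)
    (hp' : Partner a b c d x y') : y = y' := by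
  have h1 := h.ne_left
  have h2 := h.ne_right
  have ha := h.no_common a (by simp [h.adj_left])
  have hb := h.no_common b (by simp [h.adj_left])
  simp only [h.adj_right, not_or] at ha hb
  unfold Partner at hp hp'
  grind

end IsGluingSite

section Adjacency

variable {x y : (({u, v} : Set V)ᶜ : Set V)}

theorem gluedGraph_adj_inl_inl : (gluedGraph B u v a b c d).Adj (.inl x) (.inl y) ↔ B.Adj x y := by
  simp [gluedGraph]

theorem gluedGraph_adj_inr_inr : (gluedGraph B u v a b c d).Adj (.inr x) (.inr y) ↔ B.Adj x y := by
  simp [gluedGraph]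

theorem gluedGraph_adj_inl_inr :
    (gluedGraph B u v a b c d).Adj (.inl x) (.inr y) ↔ Partner a b c d (x : V) y := by
  simp only [gluedGraph, sup_adj, fromRel_adj, Partner, Sum.inl.injEq, Sum.inr.injEq]
  constructor
  · rintro (h | ⟨-, ⟨x', y', rfl, rfl, h⟩ | ⟨x', y', h, -⟩⟩)
    · simp at h
    · exact h
    · simp at h
  · exact fun h => .inr ⟨by simp, .inl ⟨x, y, rfl, rfl, h⟩⟩

theorem gluedGraph_adj_swap {p q : (({u, v} : Set V)ᶜ : Set V) ⊕ (({u, v} : Set V)ᶜ : Set V)} :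
    (gluedGraph B u v a b c d).Adj p.swap q.swap ↔ (gluedGraph B u v a b c d).Adj p q := by
  rcases p with p | p <;> rcases q with q | q
  · simp [gluedGraph_adj_inl_inl, gluedGraph_adj_inr_inr]
  · rw [Sum.swap_inl, Sum.swap_inr, adj_comm, gluedGraph_adj_inl_inr, gluedGraph_adj_inl_inr]
    exact ⟨.symm, .symm⟩
  · rw [Sum.swap_inl, Sum.swap_inr, adj_comm _ (Sum.inr p), gluedGraph_adj_inl_inr,
      gluedGraph_adj_inl_inr]
    exact ⟨.symm, .symm⟩
  · simp [gluedGraph_adj_inl_inl, gluedGraph_adj_inr_inr]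

end Adjacency

/-- Since `u` and `v` have no common neighbour, a vertex loses at most one neighbour when they are
deleted; it loses one exactly when it has a partner, which is unique. -/
theorem IsGluingSite.ncard_partner_add (h : IsGluingSite B u v a b c d) (hB : IsCubic B)
    (x : (({u, v} : Set V)ᶜ : Set V)) :
    {y : (({u, v} : Set V)ᶜ : Set V) | B.Adj x y}.ncard +
      {y : (({u, v} : Set V)ᶜ : Set V) | Partner a b c d (x : V) y}.ncard = 3 := by
  rw [isCubic_iff_ncard] at hB
  have hxu : (x : V) ≠ u := fun h => x.2 (by simp [h])
  have hxv : (x : V) ≠ v := fun h => x.2 (by simp [h])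
  have h1 : {y : (({u, v} : Set V)ᶜ : Set V) | B.Adj x y}.ncard =
      ((B.neighborSet x \ {u}) \ {v}).ncard := by
    rw [← Set.ncard_image_of_injective _ Subtype.val_injective]
    congr 1
    ext w
    constructor
    · rintro ⟨w, hw, rfl⟩
      exact ⟨⟨hw, fun h => w.2 (.inl h)⟩, fun h => w.2 (.inr h)⟩
    · rintro ⟨⟨hw, hwu⟩, hwv⟩
      exact ⟨⟨w, fun h => h.elim hwu hwv⟩, hw, rfl⟩
  have h2 : ∀ y : V, y ≠ u → y ≠ v → Partner a b c d (x : V) y →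
      {y : (({u, v} : Set V)ᶜ : Set V) | Partner a b c d (x : V) y}.ncard = 1 := by
    intro y hyu hyv hy
    rw [Set.ncard_eq_one]
    refine ⟨⟨y, by simp [hyu, hyv]⟩, Set.eq_singleton_iff_unique_mem.2 ⟨hy, ?_⟩⟩
    intro z hz
    exact Subtype.ext (h.partner_unique hz hy)
  rw [h1]
  by_cases hu : B.Adj u x
  · have hv := h.no_common x hu
    obtain ⟨y, hy, hyu, hyv⟩ := h.exists_partner_left hu hxv
    rw [h2 y hyu.ne' hyv hy, 
      Set.sdiff_singleton_eq_self (fun hh => hv (mem_neighborSet _ _ _ |>.1 hh.1).symm),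
      Set.ncard_sdiff_singleton_of_mem ((mem_neighborSet _ _ _).2 hu.symm), hB]
  · by_cases hv : B.Adj v x
    · obtain ⟨y, hy, hyv, hyu⟩ := h.exists_partner_right hv hxu
      rw [h2 y hyu hyv.ne' hy,
        Set.sdiff_singleton_eq_self (fun hh => hu (mem_neighborSet _ _ _ |>.1 hh).symm),
        Set.ncard_sdiff_singleton_of_mem ((mem_neighborSet _ _ _).2 hv.symm), hB]
    · have h3 : {y : (({u, v} : Set V)ᶜ : Set V) | Partner a b c d (x : V) y} = ∅ := by
        refine Set.eq_empty_of_forall_notMem fun y hy => ?_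
        rcases h.adj_of_partner hy with h3 | h3
        · exact hu h3.1
        · exact hv h3.1
      rw [h3, Set.ncard_empty,
        Set.sdiff_singleton_eq_self (fun hh => hu (mem_neighborSet _ _ _ |>.1 hh).symm),
        Set.sdiff_singleton_eq_self (fun hh => hv (mem_neighborSet _ _ _ |>.1 hh).symm), hB]

theorem IsGluingSite.isCubic_gluedGraph [Finite V] (h : IsGluingSite B u v a b c d)
    (hB : IsCubic B) : IsCubic (gluedGraph B u v a b c d) := by
  rw [isCubic_iff_ncard]
  have hl : ∀ x, ((gluedGraph B u v a b c d).neighborSet (.inl x)).ncard = 3 := by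
    intro x
    rw [← h.ncard_partner_add hB x]
    have h1 : (gluedGraph B u v a b c d).neighborSet (.inl x) =
        Sum.inl '' {y : (({u, v} : Set V)ᶜ : Set V) | B.Adj x y} ∪ 
          Sum.inr '' {y : (({u, v} : Set V)ᶜ : Set V) | Partner a b c d (x : V) y} := by
      ext y
      rcases y with y | y
      · simp [gluedGraph_adj_inl_inl]
      · simp [gluedGraph_adj_inl_inr]
    rw [h1, Set.ncard_union_eq, Set.ncard_image_of_injective _ Sum.inl_injective,
      Set.ncard_image_of_injective _ Sum.inr_injective]
    rw [Set.disjoint_left]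
    rintro _ ⟨y, -, rfl⟩ ⟨z, -, hz⟩
    exact Sum.inr_ne_inl hz
  rintro (x | x)
  · exact hl x
  · rw [← hl x]
    have h1 : (gluedGraph B u v a b c d).neighborSet (.inr x) =
        Sum.swap '' (gluedGraph B u v a b c d).neighborSet (.inl x) := by
      ext y
      constructor
      · intro hy
        exact ⟨y.swap, gluedGraph_adj_swap.1 (by simpa using hy), by simp⟩
      · rintro ⟨y, hy, rfl⟩
        exact gluedGraph_adj_swap.2 hy
    rw [h1, Set.ncard_image_of_injective _ Sum.swap_leftInverse.injective]

end CubicGirth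

/-! ### The girth of the glued graph -/

namespace CubicGirth
open SimpleGraph

variable {V : Type*} {B : SimpleGraph V} {u v a b c d : V} {g : ℕ}

theorem _root_.SimpleGraph.Walk.exists_edges_eq_append {G : SimpleGraph V} {p q x y : V}
    (w : G.Walk p q) (h : s(x, y) ∈ w.edges) :
    (∃ (w₁ : G.Walk p x) (w₂ : G.Walk y q), w.edges = w₁.edges ++ s(x, y) :: w₂.edges) ∨
      ∃ (w₁ : G.Walk p y) (w₂ : G.Walk x q), w.edges = w₁.edges ++ s(x, y) :: w₂.edges := by
  induction w with
  | nil => simp at h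
  | @cons p r q hpr w ih =>
    rw [Walk.edges_cons, List.mem_cons] at h
    by_cases h' : s(x, y) ∈ w.edges
    · rcases ih h' with ⟨w₁, w₂, hw⟩ | ⟨w₁, w₂, hw⟩
      · exact .inl ⟨.cons hpr w₁, w₂, by simp [hw]⟩
      · exact .inr ⟨.cons hpr w₁, w₂, by simp [hw]⟩
    · rcases Sym2.eq_iff.1 (h.resolve_right h') with ⟨rfl, rfl⟩ | ⟨rfl, rfl⟩
      · exact .inl ⟨.nil, w, by simp⟩
      · exact .inr ⟨.nil, w, by simp [Sym2.eq_swap]⟩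

/-- The endpoints of an edge of a closed trail are joined by the rest of the trail. -/
theorem _root_.SimpleGraph.Walk.IsTrail.exists_walk_avoiding {G : SimpleGraph V} {p x y : V}
    {w : G.Walk p p} (hw : w.IsTrail) (h : s(x, y) ∈ w.edges) :
    ∃ q : G.Walk x y, s(x, y) ∉ q.edges ∧ q.length + 1 = w.length := by
  have hn := hw.edges_nodup
  rcases w.exists_edges_eq_append h with ⟨w₁, w₂, hw⟩ | ⟨w₁, w₂, hw⟩
  · refine ⟨(w₂.append w₁).reverse, ?_, ?_⟩
    · rw [hw, List.nodup_middle, List.nodup_cons] at hn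
      simpa [or_comm] using hn.1
    · have := congrArg List.length hw
      simp at this ⊢
      omega
  · refine ⟨w₂.append w₁, ?_, ?_⟩
    · rw [hw, List.nodup_middle, List.nodup_cons] at hn
      simpa [or_comm] using hn.1
    · have := congrArg List.length hw
      simp at this ⊢
      omega

theorem _root_.SimpleGraph.Walk.apply_le_add_length {G : SimpleGraph V} {e : Sym2 V} {φ : V → ℕ}
    (hφ : ∀ x y, G.Adj x y → s(x, y) ≠ e → φ y ≤ φ x + 1) {x y : V} (p : G.Walk x y)
    (hp : e ∉ p.edges) : φ y ≤ φ x + p.length := by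
  induction p with
  | nil => simp
  | cons h p ih =>
    rw [Walk.edges_cons, List.mem_cons, not_or] at hp
    have h1 := hφ _ _ h (Ne.symm hp.1)
    have h2 := ih hp.2
    rw [Walk.length_cons]
    omega

/-- The projection of both copies onto the original graph. -/
def foldCopies (B : SimpleGraph V) (s : Set V) : B.induce s ⊕g B.induce s →g B where
  toFun := Sum.elim Subtype.val Subtype.val
  map_rel' {p q} h := by
    rcases p with p | p <;> rcases q with q | q <;> simp_all

theorem le_length_add_three_of_induce {x y : (({u, v} : Set V)ᶜ : Set V)}
    (hg : (g : ℕ∞) ≤ B.egirth) (huv : B.Adj u v)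
    (hconn : (B.induce ({u, v} : Set V)ᶜ).Connected) (hxy : x ≠ y)
    (hx : B.Adj u x ∨ B.Adj v x) (hy : B.Adj u y ∨ B.Adj v y) :
    g ≤ (B.induce ({u, v} : Set V)ᶜ).dist x y + 3 := by
  obtain ⟨p, hp, hlen⟩ := hconn.exists_path_of_dist x y
  rw [← hlen]
  have key := le_length_add_three hg huv (p := p.map (Embedding.induce (G := B) _).toHom)
    (hp.map (Embedding.induce (G := B) _).injective) (fun h => hxy (Subtype.ext h)) ?_ ?_ hx hy
  · exact key.trans (Nat.add_le_add_right (Walk.length_map _ p).le 3)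
  all_goals
    rw [Walk.support_map, List.mem_map]
    rintro ⟨z, -, hz⟩
    refine z.2 ?_
    change (z : V) = _ at hz
    simp [hz]

theorem IsGluingSite.le_egirth_gluedGraph (h : IsGluingSite B u v a b c d) (h4 : 4 ≤ g)
    (hg : (g : ℕ∞) ≤ B.egirth) (hconn : (B.induce ({u, v} : Set V)ᶜ).Connected) :
    (g : ℕ∞) ≤ (gluedGraph B u v a b c d).egirth := by
  rw [le_egirth]
  intro z w hw
  rw [Nat.cast_le]
  by_cases hcross : ∃ x y : (({u, v} : Set V)ᶜ : Set V),
      s(Sum.inl x, Sum.inr y) ∈ w.edges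
  · obtain ⟨x, y, hxy⟩ := hcross
    obtain ⟨q, hq, hlen⟩ := hw.isTrail.exists_walk_avoiding hxy
    have hadj := gluedGraph_adj_inl_inr.1 (w.adj_of_mem_edges hxy)
    have hend : ∀ {x y : V}, Partner a b c d x y → (B.Adj u x ∨ B.Adj v x) := fun hp =>
      (h.adj_of_partner hp).imp And.left And.left
    set H := B.induce ({u, v} : Set V)ᶜ with hH
    have hd : ∀ s t t', H.Adj t t' → H.dist s t' ≤ H.dist s t + 1 := fun s t t' ht => by
      have := hconn.dist_triangle (u := s) (v := t) (w := t')
      rwa [dist_eq_one_iff_adj.2 ht] at this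
    -- A potential rising from `0` at `x` to `2(g - 3) + 1` at `y`. Truncating at `g - 3` makes it
    -- `g - 3` and `g - 2` at the two ends of every other crossing edge, so it grows by at most one
    -- per step of `q`.
    let φ : (({u, v} : Set V)ᶜ : Set V) ⊕ (({u, v} : Set V)ᶜ : Set V) → ℕ :=
      Sum.elim (fun t => min (H.dist x t) (g - 3))
        (fun t => 2 * (g - 3) + 1 - min (H.dist y t) (g - 3))
    have hcr : ∀ t t' : (({u, v} : Set V)ᶜ : Set V), Partner a b c d (t : V) t' →
        s(Sum.inl t, Sum.inr t') ≠ s(Sum.inl x, Sum.inr y) →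
        g - 3 ≤ H.dist x t ∧ g - 3 ≤ H.dist y t' := by
      intro t t' ht hne
      have h1 : x ≠ t := by
        rintro rfl
        exact hne (by rw [Subtype.ext (h.partner_unique ht hadj)])
      have h2 : y ≠ t' := by
        rintro rfl
        exact hne (by rw [Subtype.ext (h.partner_unique ht.symm hadj.symm)])
      have h3 : g ≤ H.dist x t + 3 :=
        le_length_add_three_of_induce hg h.adj hconn h1 (hend hadj) (hend ht)
      have h4 : g ≤ H.dist y t' + 3 :=
        le_length_add_three_of_induce hg h.adj hconn h2 (hend hadj.symm) (hend ht.symm)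
      omega
    have key := q.apply_le_add_length (φ := φ) ?_ hq
    · simp only [φ, Sum.elim_inl, Sum.elim_inr, SimpleGraph.dist_self] at key
      -- The cycle has length at least `2(g - 3) + 2 = 2g - 4`, which is at least `g` because `4 ≤
      -- g`.
      omega
    rintro (t | t) (t' | t') htt hne
    · have := hd x t t' (gluedGraph_adj_inl_inl.1 htt)
      simp only [φ, Sum.elim_inl]
      omega
    · have := hcr t t' (gluedGraph_adj_inl_inr.1 htt) hne
      simp only [φ, Sum.elim_inl, Sum.elim_inr]
      omega
    · have := hcr t' t (gluedGraph_adj_inl_inr.1 htt.symm) (by rwa [Sym2.eq_swap])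
      simp only [φ, Sum.elim_inl, Sum.elim_inr]
      omega
    · have := hd y t' t (gluedGraph_adj_inr_inr.1 htt).symm
      simp only [φ, Sum.elim_inr]
      omega
  · push Not at hcross
    have hsub : ∀ e ∈ w.edges, e ∈ (B.induce ({u, v} : Set V)ᶜ ⊕g B.induce ({u, v} : Set V)ᶜ).edgeSet := by
      intro e he
      have hadj := w.edges_subset_edgeSet he
      induction e with
      | h p q =>
        rcases p with p | p <;> rcases q with q | q
        · simpa [gluedGraph_adj_inl_inl] using hadj
        · exact absurd he (hcross _ _)
        · rw [Sym2.eq_swap] at he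
          exact absurd he (hcross _ _)
        · simpa [gluedGraph_adj_inr_inr] using hadj
    obtain ⟨r, k, hk, hkw⟩ := exists_isCycle_of_map (foldCopies B ({u, v} : Set V)ᶜ) (by
      rintro (x | x) (y | y) (z | z) hxy hyz hxz <;> simp at hxy hyz <;>
        exact congrArg _ (Subtype.ext hxz)) (hw.transfer hsub)
    have h1 := le_egirth.1 hg _ _ hk
    have h2 := (hk.edges_nodup.subperm hkw).length_le
    simp only [Walk.length_edges, Walk.length_map, Walk.length_transfer] at h2
    rw [Nat.cast_le] at h1
    omega

end CubicGirth

/-! ### 3-connectedness of the glued graph -/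

namespace CubicGirth
open SimpleGraph

variable {V : Type*} {B : SimpleGraph V} {u v a b c d : V}

theorem IsVertexConnected.compl_subset {k : ℕ} (h : IsVertexConnected B k) {S : Finset V}
    (hS : S.card < k) {X : Set V} (hX : X.Nonempty) (hXS : ∀ x ∈ X, x ∉ S)
    (hcl : ∀ x ∈ X, ∀ y, B.Adj x y → y ∈ X ∨ y ∈ S) {z : V} (hz : z ∉ S) : z ∈ X :=
  (induce_connected_iff.1 (h.2 S hS)).2 X (fun x hx => hXS x hx) hX
    (fun x hx y hy hxy => (hcl x hx y hxy).resolve_right hy) hz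

/-- Otherwise `L` together with `r'`, at most two vertices, would separate `X` from `r`. -/
theorem IsVertexConnected.exists_adj (h : IsVertexConnected B 3) {L : Finset V} (hL : L.card < 2)
    {X : Set V} {r r' : V} (hX : X.Nonempty) (hXL : ∀ x ∈ X, x ∉ L) (hr : r ∉ X) (hr' : r' ∉ X)
    (hrL : r ∉ L) (hrr' : r ≠ r')
    (hcl : ∀ x ∈ X, ∀ y, B.Adj x y → y ∈ X ∨ y ∈ L ∨ y = r ∨ y = r') : ∃ x ∈ X, B.Adj r x := by
  classical
  by_contra! hcon
  refine hr (h.compl_subset (S := insert r' L) ?_ hX ?_ ?_ (z := r) ?_)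
  · have := Finset.card_insert_le r' L
    omega
  · intro x hx hxS
    rcases Finset.mem_insert.1 hxS with rfl | hxL
    · exact hr' hx
    · exact hXL x hx hxL
  · intro x hx y hxy
    rw [Finset.mem_insert]
    rcases hcl x hx y hxy with h1 | h1 | rfl | h1
    · exact .inl h1
    · exact .inr (.inr h1)
    · exact absurd hxy.symm (hcon x hx)
    · exact .inr (.inl h1)
  · rw [Finset.mem_insert, not_or]
    exact ⟨hrr', hrL⟩

/-- A separation of the glued graph after deleting `L` from one copy and `R` from the other: the
first copy splits into `P` and `P'`, the second into `Q` and `Q'`, and no edge joins `P ∪ Q` to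
`P' ∪ Q'`. -/
structure IsSeparation (B : SimpleGraph V) (u v a b c d : V) (L R : Finset V)
    (P P' Q Q' : Set V) : Prop where
  left : ∀ x, x ∈ P ∨ x ∈ P' ↔ x ≠ u ∧ x ≠ v ∧ x ∉ L
  right : ∀ x, x ∈ Q ∨ x ∈ Q' ↔ x ≠ u ∧ x ≠ v ∧ x ∉ R
  disj_left : ∀ x ∈ P, x ∉ P'
  disj_right : ∀ x ∈ Q, x ∉ Q'
  not_adj_left : ∀ x ∈ P, ∀ y ∈ P', ¬ B.Adj x y
  not_adj_right : ∀ x ∈ Q, ∀ y ∈ Q', ¬ B.Adj x y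
  not_partner : ∀ x ∈ P, ∀ y ∈ Q', ¬ Partner a b c d x y
  not_partner' : ∀ x ∈ P', ∀ y ∈ Q, ¬ Partner a b c d x y

namespace IsSeparation

variable {L R : Finset V} {P P' Q Q' : Set V}

theorem flip (h : IsSeparation B u v a b c d L R P P' Q Q') :
    IsSeparation B u v a b c d L R P' P Q' Q where
  left x := or_comm.trans (h.left x)
  right x := or_comm.trans (h.right x)
  disj_left x hx hx' := h.disj_left x hx' hx
  disj_right x hx hx' := h.disj_right x hx' hx
  not_adj_left x hx y hy hxy := h.not_adj_left y hy x hx hxy.symm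
  not_adj_right x hx y hy hxy := h.not_adj_right y hy x hx hxy.symm
  not_partner := h.not_partner'
  not_partner' := h.not_partner

theorem swap (h : IsSeparation B u v a b c d L R P P' Q Q') :
    IsSeparation B u v a b c d R L Q Q' P P' where
  left := h.right
  right := h.left
  disj_left := h.disj_right
  disj_right := h.disj_left
  not_adj_left := h.not_adj_right
  not_adj_right := h.not_adj_left
  not_partner x hx y hy hxy := h.not_partner' y hy x hx hxy.symm
  not_partner' x hx y hy hxy := h.not_partner y hy x hx hxy.symm

theorem closed_left (h : IsSeparation B u v a b c d L R P P' Q Q') {x y : V} (hx : x ∈ P)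
    (hxy : B.Adj x y) : y ∈ P ∨ y ∈ L ∨ y = u ∨ y = v := by
  by_cases hy : y ∈ P ∨ y ∈ P'
  · exact .inl (hy.resolve_right fun hy' => h.not_adj_left x hx y hy' hxy)
  · rw [h.left] at hy
    tauto

theorem mem_left (h : IsSeparation B u v a b c d L R P P' Q Q') {x : V} (hx : x ∈ P) :
    x ≠ u ∧ x ≠ v ∧ x ∉ L := (h.left x).1 (.inl hx)

/-- In an undamaged copy only one side of a separation is present. -/
theorem left_eq_empty_or (h : IsSeparation B u v a b c d ∅ R P P' Q Q')
    (h3 : IsVertexConnected B 3) : P = ∅ ∨ P' = ∅ := by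
  classical
  by_contra! hne
  obtain ⟨hP, ⟨z, hz⟩⟩ := hne
  have hzm := h.flip.mem_left hz
  refine h.flip.disj_left z hz (h3.compl_subset (S := {u, v}) ?_ hP ?_ ?_ ?_)
  · have := Finset.card_le_two (a := u) (b := v)
    omega
  · intro x hx
    have := h.mem_left hx
    simp [this.1, this.2.1]
  · intro x hx y hxy
    have := h.closed_left hx hxy
    simpa using this
  · simp [hzm.1, hzm.2.1]

theorem exists_attachment (h : IsSeparation B u v a b c d L R P P' Q Q')
    (h3 : IsVertexConnected B 3) (hL : L.card < 3) (huL : u ∉ L) (hP : P.Nonempty) :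
    ∃ x ∈ P, B.Adj u x ∨ B.Adj v x := by
  by_contra! hcon
  refine (h.mem_left (h3.compl_subset hL hP (fun x hx => (h.mem_left hx).2.2) ?_ huL)).1 rfl
  intro x hx y hxy
  rcases h.closed_left hx hxy with h1 | h1 | rfl | rfl
  · exact .inl h1
  · exact .inr h1
  · exact absurd hxy.symm (hcon x hx).1
  · exact absurd hxy.symm (hcon x hx).2

/-- The undamaged copy is connected, so it lies on one side. The other side then lives in the
damaged copy alone, yet it contains an attachment vertex, whose partner was not deleted. -/
theorem false_of_right_empty (h : IsSeparation B u v a b c d L ∅ P P' Q Q')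
    (hs : IsGluingSite B u v a b c d) (h3 : IsVertexConnected B 3) (hL : L.card < 3)
    (huL : u ∉ L) (hPQ : (P ∪ Q).Nonempty) (hPQ' : (P' ∪ Q').Nonempty) : False := by
  have key : ∀ {P P' Q : Set V}, IsSeparation B u v a b c d L ∅ P P' Q ∅ →
      P'.Nonempty → False := by
    intro P P' Q h hP'
    obtain ⟨x, hx, hux⟩ := h.flip.exists_attachment h3 hL huL hP'
    have hxm := h.flip.mem_left hx
    obtain ⟨y, hy, hyu, hyv⟩ : ∃ y, Partner a b c d x y ∧ y ≠ u ∧ y ≠ v := by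
      rcases hux with hux | hvx
      · obtain ⟨y, hy, h1, h2⟩ := hs.exists_partner_left hux hxm.2.1
        exact ⟨y, hy, h1.ne', h2⟩
      · obtain ⟨y, hy, h1, h2⟩ := hs.exists_partner_right hvx hxm.1
        exact ⟨y, hy, h2, h1.ne'⟩
    rcases (h.right y).2 ⟨hyu, hyv, by simp⟩ with h1 | h1
    · exact h.not_partner' x hx y h1 hy
    · exact h1
  rcases h.swap.left_eq_empty_or h3 with rfl | rfl
  · exact key h.flip (by simpa using hPQ)
  · exact key h (by simpa using hPQ')

theorem exists_left_adj (h : IsSeparation B u v a b c d L R P P' Q Q') (huv : u ≠ v)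
    (h3 : IsVertexConnected B 3) (hL : L.card < 2) (huL : u ∉ L) (hvL : v ∉ L)
    (hP : P.Nonempty) : (∃ x ∈ P, B.Adj u x) ∧ ∃ x ∈ P, B.Adj v x := by
  refine ⟨h3.exists_adj hL hP (fun x hx => (h.mem_left hx).2.2) (fun hu => (h.mem_left hu).1 rfl)
    (fun hv => (h.mem_left hv).2.1 rfl) huL huv fun x hx y hxy => h.closed_left hx hxy,
    h3.exists_adj hL hP (fun x hx => (h.mem_left hx).2.2) (fun hu => (h.mem_left hu).2.1 rfl)
    (fun hv => (h.mem_left hv).1 rfl) hvL huv.symm fun x hx y hxy => ?_⟩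
  have := h.closed_left hx hxy
  tauto

/-- If `P` were empty, `Q` would still contain a neighbour of `u` and one of `v`. Both partners
would have to be deleted, hence coincide in `L`, giving `u` and `v` a common neighbour. -/
theorem nonempty_left (h : IsSeparation B u v a b c d L R P P' Q Q')
    (hs : IsGluingSite B u v a b c d) (h3 : IsVertexConnected B 3) (hL : L.card < 2)
    (hR : R.card < 2) (huR : u ∉ R) (hvR : v ∉ R) (hPQ : (P ∪ Q).Nonempty) : P.Nonempty := by
  by_contra hP
  rw [Set.not_nonempty_iff_eq_empty] at hP
  subst hP
  obtain ⟨⟨x, hx, hux⟩, x', hx', hvx'⟩ :=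
    h.swap.exists_left_adj hs.adj.ne h3 hR huR hvR (by simpa using hPQ)
  obtain ⟨y, hy, huy, hyv⟩ := hs.exists_partner_left hux (h.swap.mem_left hx).2.1
  obtain ⟨y', hy', hvy', hyu'⟩ := hs.exists_partner_right hvx' (h.swap.mem_left hx').1
  have hyL : y ∈ L := by
    by_contra hyL
    rcases (h.left y).2 ⟨huy.ne', hyv, hyL⟩ with h1 | h1
    · exact h1
    · exact h.not_partner' y h1 x hx hy.symm
  have hyL' : y' ∈ L := by
    by_contra hyL
    rcases (h.left y').2 ⟨hyu', hvy'.ne', hyL⟩ with h1 | h1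
    · exact h1
    · exact h.not_partner' y' h1 x' hx' hy'.symm
  have := Finset.card_le_one.1 (Nat.le_of_lt_succ hL) y hyL y' hyL'
  subst this
  exact hs.no_common y huy hvy'

/-- The common part of two sides in the same copy is still attached to `v`. -/
theorem exists_mem_inter_adj (h : IsSeparation B u v a b c d L R P P' Q Q') (huv : u ≠ v)
    (h3 : IsVertexConnected B 3) (hL : L.card < 2) (hvL : v ∉ L)
    (hRP : ∀ t ∈ R, t ∉ P) (hne : (P ∩ Q).Nonempty) : ∃ x ∈ P ∩ Q, B.Adj v x := by
  refine h3.exists_adj (r' := u) hL hne (fun x hx => (h.mem_left hx.1).2.2)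
    (fun hv => (h.mem_left hv.1).2.1 rfl) (fun hu => (h.mem_left hu.1).1 rfl) hvL huv.symm
    fun x hx y hxy => ?_
  rcases h.closed_left hx.1 hxy with h1 | h1 | h1 | h1
  · have := h.swap.closed_left hx.2 hxy
    have := hRP y
    simp only [Set.mem_inter_iff]
    tauto
  all_goals tauto

/-- The neighbours `e`, `f` of `v` lie in the mixed intersections, so `v` has no neighbour in `P ∩
Q` or in `P' ∩ Q'`. The at most one vertex of `R` misses `P` or `P'`; the corresponding intersection
then has its boundary in `L ∪ {u}`, which cannot separate it from `v`. -/
theorem false_of_crossing (h : IsSeparation B u v a b c d L R P P' Q Q') (huv : u ≠ v)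
    (h3 : IsVertexConnected B 3) (hL : L.card < 2) (hR : R.card < 2) (hvL : v ∉ L)
    {p p' e f : V} (hp : p ∈ P ∩ Q) (hp' : p' ∈ P' ∩ Q') (heP : e ∈ P) (heQ : e ∈ Q')
    (hfP : f ∈ P') (hfQ : f ∈ Q) (hv : ∀ x, B.Adj v x → x = u ∨ x = e ∨ x = f) : False := by
  by_cases hRP : ∀ t ∈ R, t ∉ P
  · obtain ⟨x, hx, hvx⟩ := h.exists_mem_inter_adj huv h3 hL hvL hRP ⟨p, hp⟩
    rcases hv x hvx with rfl | rfl | rfl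
    · exact (h.mem_left hx.1).1 rfl
    · exact h.disj_right _ hx.2 heQ
    · exact h.disj_left _ hx.1 hfP
  · push Not at hRP
    obtain ⟨t, ht, htP⟩ := hRP
    have hRP' : ∀ t' ∈ R, t' ∉ P' := fun t' ht' htP' => by
      rw [Finset.card_le_one.1 (Nat.le_of_lt_succ hR) t' ht' t ht] at htP'
      exact h.disj_left t htP htP'
    obtain ⟨x, hx, hvx⟩ := h.flip.exists_mem_inter_adj huv h3 hL hvL hRP' ⟨p', hp'⟩
    rcases hv x hvx with rfl | rfl | rfl
    · exact (h.flip.mem_left hx.1).1 rfl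
    · exact h.disj_left _ heP hx.1
    · exact h.disj_right _ hfQ hx.2

theorem false_of_card_lt_two (h : IsSeparation B u v a b c d L R P P' Q Q')
    (hs : IsGluingSite B u v a b c d) (h3 : IsVertexConnected B 3) (hL : L.card < 2)
    (hR : R.card < 2) (huL : u ∉ L) (hvL : v ∉ L) (huR : u ∉ R) (hvR : v ∉ R)
    (hPQ : (P ∪ Q).Nonempty) (hPQ' : (P' ∪ Q').Nonempty) : False := by
  have huv := hs.adj.ne
  -- Each side of a copy contains exactly one attachment vertex of each kind.
  have split : ∀ {L R : Finset V} {P P' Q Q' : Set V},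
      IsSeparation B u v a b c d L R P P' Q Q' → L.card < 2 → R.card < 2 → u ∉ L → v ∉ L →
      u ∉ R → v ∉ R → (P ∪ Q).Nonempty → (P' ∪ Q').Nonempty →
      (a ∈ P ∧ b ∈ P' ∨ b ∈ P ∧ a ∈ P') ∧ (c ∈ P ∧ d ∈ P' ∨ d ∈ P ∧ c ∈ P') := by
    intro L R P P' Q Q' h hL hR huL hvL huR hvR hPQ hPQ'
    obtain ⟨⟨x, hx, hux⟩, y, hy, hvy⟩ := h.exists_left_adj huv h3 hL huL hvL
      (h.nonempty_left hs h3 hL hR huR hvR hPQ)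
    obtain ⟨⟨x', hx', hux'⟩, y', hy', hvy'⟩ := h.flip.exists_left_adj huv h3 hL huL hvL
      (h.flip.nonempty_left hs h3 hL hR huR hvR hPQ')
    have hxv := (h.mem_left hx).2.1
    have hyu := (h.mem_left hy).1
    have hxv' := (h.flip.mem_left hx').2.1
    have hyu' := (h.flip.mem_left hy').1
    have hxx : x ≠ x' := fun hh => h.disj_left x hx (hh ▸ hx')
    have hyy : y ≠ y' := fun hh => h.disj_left y hy (hh ▸ hy')
    rw [hs.adj_left] at hux hux'
    rw [hs.adj_right] at hvy hvy'
    grind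
  obtain ⟨hab, hcd⟩ := split h hL hR huL hvL huR hvR hPQ hPQ'
  obtain ⟨hab', hcd'⟩ := split h.swap hR hL huR hvR huL hvL (by rwa [Set.union_comm])
    (by rwa [Set.union_comm])
  -- The straight edges `aa'`, `bb'` put `a` and `b` on matching sides in both copies.
  obtain ⟨p, p', hp, hp'⟩ : ∃ p p', p ∈ P ∩ Q ∧ p' ∈ P' ∩ Q' := by
    rcases hab with hab | hab
    · have := hab'.resolve_right fun k => h.not_partner a hab.1 a k.2 (by simp [Partner])
      exact ⟨a, b, ⟨hab.1, this.1⟩, hab.2, this.2⟩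
    · have := hab'.resolve_left fun k => h.not_partner b hab.1 b k.2 (by simp [Partner])
      exact ⟨b, a, ⟨hab.1, this.1⟩, hab.2, this.2⟩
  -- The twisted edges put `c` and `d` on opposite sides in the two copies, hence in the mixed
  -- intersections.
  rcases hcd with hcd | hcd
  · have := hcd'.resolve_left fun k => h.not_partner c hcd.1 d k.2 (by simp [Partner])
    exact h.false_of_crossing huv h3 hL hR hvL hp hp' hcd.1 this.2 hcd.2 this.1
      fun x => (hs.adj_right x).1
  · have := hcd'.resolve_right fun k => h.not_partner d hcd.1 c k.2 (by simp [Partner])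
    exact h.false_of_crossing huv h3 hL hR hvL hp hp' hcd.1 this.2 hcd.2 this.1
      fun x hx => ((hs.adj_right x).1 hx).imp_right Or.symm

theorem false_of_nonempty (h : IsSeparation B u v a b c d L R P P' Q Q')
    (hs : IsGluingSite B u v a b c d) (h3 : IsVertexConnected B 3) (hLR : L.card + R.card < 3)
    (huL : u ∉ L) (hvL : v ∉ L) (huR : u ∉ R) (hvR : v ∉ R)
    (hPQ : (P ∪ Q).Nonempty) (hPQ' : (P' ∪ Q').Nonempty) : False := by
  rcases Finset.eq_empty_or_nonempty R with rfl | hR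
  · exact h.false_of_right_empty hs h3 (by omega) huL hPQ hPQ'
  rcases Finset.eq_empty_or_nonempty L with rfl | hL
  · exact h.swap.false_of_right_empty hs h3 (by omega) huR (by rwa [Set.union_comm])
      (by rwa [Set.union_comm])
  have := hR.card_pos
  have := hL.card_pos
  exact h.false_of_card_lt_two hs h3 (by omega) (by omega) huL hvL huR hvR hPQ hPQ'

end IsSeparation

theorem IsGluingSite.card_copies [Finite V] (h : IsGluingSite B u v a b c d) :
    Nat.card ((({u, v} : Set V)ᶜ : Set V) ⊕ (({u, v} : Set V)ᶜ : Set V)) =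
      2 * (Nat.card V - 2) := by
  rw [Nat.card_sum, Nat.card_coe_set_eq, Set.ncard_compl, Set.ncard_pair h.adj.ne]
  omega

/-- A closed set `D` and its complement outside `S`, each restricted to the two copies and pushed
into `V`, form a separation in the sense of `IsSeparation`. -/
theorem IsGluingSite.isVertexConnected_gluedGraph [Finite V] (h : IsGluingSite B u v a b c d)
    (hB : IsCubic B) (h3 : IsVertexConnected B 3) :
    IsVertexConnected (gluedGraph B u v a b c d) 3 := by
  classical
  have : Nonempty V := ⟨u⟩
  have hcard := h.card_copies
  have h4 := hB.four_le_card
  refine ⟨?_, fun S hS => ?_⟩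
  · rw [ENat.card_eq_coe_natCard, hcard]
    exact_mod_cast (by omega : 3 < 2 * (Nat.card V - 2))
  rw [induce_connected_iff]
  constructor
  · rw [Set.nonempty_compl]
    intro hu
    have := Set.ncard_coe_finset S
    rw [hu, Set.ncard_univ, hcard] at this
    omega
  intro D hDS ⟨d₀, hd₀⟩ hD
  by_contra hcon
  obtain ⟨z, hzS, hzD⟩ := Set.not_subset.1 hcon
  let L : Finset V := S.toLeft.map (.subtype _)
  let R : Finset V := S.toRight.map (.subtype _)
  have hL : ∀ x, x ∈ L ↔ ∃ hx, Sum.inl ⟨x, hx⟩ ∈ S := fun x => by simp [L]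
  have hR : ∀ x, x ∈ R ↔ ∃ hx, Sum.inr ⟨x, hx⟩ ∈ S := fun x => by simp [R]
  have hLR : L.card + R.card < 3 := by
    rw [Finset.card_map, Finset.card_map, Finset.card_toLeft_add_card_toRight]
    exact hS
  have hmem : ∀ x, x ∈ ({u, v} : Set V)ᶜ ↔ x ≠ u ∧ x ≠ v := fun x => by simp
  have hsep : IsSeparation B u v a b c d L R {x | ∃ hx, Sum.inl ⟨x, hx⟩ ∈ D}
      {x | ∃ hx, Sum.inl ⟨x, hx⟩ ∉ S ∧ Sum.inl ⟨x, hx⟩ ∉ D} {x | ∃ hx, Sum.inr ⟨x, hx⟩ ∈ D}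
      {x | ∃ hx, Sum.inr ⟨x, hx⟩ ∉ S ∧ Sum.inr ⟨x, hx⟩ ∉ D} := by
    refine ⟨fun x => ?_, fun x => ?_, fun x hx hx' => hx'.2.2 hx.2, fun x hx hx' => hx'.2.2 hx.2,
      ?_, ?_, ?_, ?_⟩
    · rw [← and_assoc, ← hmem, hL]
      constructor
      · rintro (⟨hx, hx'⟩ | ⟨hx, hx', -⟩)
        · exact ⟨hx, fun ⟨_, h⟩ => hDS hx' h⟩
        · exact ⟨hx, fun ⟨_, h⟩ => hx' h⟩
      · rintro ⟨hx, hx'⟩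
        by_cases hxD : Sum.inl ⟨x, hx⟩ ∈ D
        · exact .inl ⟨hx, hxD⟩
        · exact .inr ⟨hx, fun h => hx' ⟨hx, h⟩, hxD⟩
    · rw [← and_assoc, ← hmem, hR]
      constructor
      · rintro (⟨hx, hx'⟩ | ⟨hx, hx', -⟩)
        · exact ⟨hx, fun ⟨_, h⟩ => hDS hx' h⟩
        · exact ⟨hx, fun ⟨_, h⟩ => hx' h⟩
      · rintro ⟨hx, hx'⟩
        by_cases hxD : Sum.inr ⟨x, hx⟩ ∈ D
        · exact .inl ⟨hx, hxD⟩
        · exact .inr ⟨hx, fun h => hx' ⟨hx, h⟩, hxD⟩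
    · rintro x ⟨hx, hxD⟩ y ⟨hy, hyS, hyD⟩ hxy
      exact hyD (hD _ hxD _ hyS (gluedGraph_adj_inl_inl.2 hxy))
    · rintro x ⟨hx, hxD⟩ y ⟨hy, hyS, hyD⟩ hxy
      exact hyD (hD _ hxD _ hyS (gluedGraph_adj_inr_inr.2 hxy))
    · rintro x ⟨hx, hxD⟩ y ⟨hy, hyS, hyD⟩ hxy
      exact hyD (hD _ hxD _ hyS (gluedGraph_adj_inl_inr.2 hxy))
    · rintro x ⟨hx, hxS, hxD⟩ y ⟨hy, hyD⟩ hxy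
      exact hxD (hD _ hyD _ hxS (gluedGraph_adj_inl_inr.2 hxy).symm)
  refine hsep.false_of_nonempty h h3 hLR ?_ ?_ ?_ ?_ ?_ ?_
  · rw [hL]; rintro ⟨hx, -⟩; exact hx (by simp)
  · rw [hL]; rintro ⟨hx, -⟩; exact hx (by simp)
  · rw [hR]; rintro ⟨hx, -⟩; exact hx (by simp)
  · rw [hR]; rintro ⟨hx, -⟩; exact hx (by simp)
  · rcases d₀ with x | x
    · exact ⟨x, .inl ⟨x.2, hd₀⟩⟩
    · exact ⟨x, .inr ⟨x.2, hd₀⟩⟩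
  · rcases z with x | x
    · exact ⟨x, .inl ⟨x.2, hzS, hzD⟩⟩
    · exact ⟨x, .inr ⟨x.2, hzS, hzD⟩⟩

/-- Gluing two copies along an edge preserves 3-connected cubic graphs of girth at least `g`. -/
theorem isCubic_isVertexConnected_dvd_card_le_girth_gluedGraph [Finite V] {g : ℕ} (hg : 4 ≤ g)
    (hB : IsCubic B) (h3 : IsVertexConnected B 3) (hgB : g ≤ B.girth) (huv : B.Adj u v)
    (hu : B.neighborSet u = {v, a, b}) (hv : B.neighborSet v = {u, c, d}) :
    IsCubic (gluedGraph B u v a b c d) ∧ IsVertexConnected (gluedGraph B u v a b c d) 3 ∧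
      4 ∣ Nat.card ((({u, v} : Set V)ᶜ : Set V) ⊕ (({u, v} : Set V)ᶜ : Set V)) ∧
      g ≤ (gluedGraph B u v a b c d).girth := by
  classical
  have heg : (g : ℕ∞) ≤ B.egirth :=
    le_trans (by exact_mod_cast hgB) (ENat.natCast_toNat_le_self B.egirth)
  have h := IsGluingSite.of_isCubic hB (le_trans (by exact_mod_cast hg) heg) huv hu hv
  have hcub := h.isCubic_gluedGraph hB
  have hconn := h.isVertexConnected_gluedGraph hB h3
  refine ⟨hcub, hconn, ?_, le_girth_of_le_egirth ?_ (hcub.not_isAcyclic ?_)⟩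
  · rw [h.card_copies]
    obtain ⟨k, hk⟩ := hB.even_card
    -- With `n = 2k` the order is `2(2k - 2) = 4(k - 1)`.
    exact ⟨k - 1, by omega⟩
  · refine h.le_egirth_gluedGraph hg heg ?_
    have := h3.2 {u, v} (lt_of_le_of_lt Finset.card_le_two (by norm_num))
    rwa [Finset.coe_pair] at this
  · have := hconn.2 ∅ (by simp)
    rw [Finset.coe_empty, Set.compl_empty] at this
    exact (Iso.connected_iff (induceUnivIso _)).1 this

end CubicGirth

theorem mainTheorem10 :
    (∀ g : ℕ, 3 ≤ g →
      ∃ (V : Type) (_ : Finite V) (G : SimpleGraph V),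
        CubicGirth.IsCubic G ∧ CubicGirth.IsVertexConnected G 3 ∧
          4 ∣ Nat.card V ∧ g ≤ G.girth) ∧
    (∀ g : ℕ, 4 ≤ g →
      ∀ (V : Type*) [Finite V] (B : SimpleGraph V),
        CubicGirth.IsCubic B → CubicGirth.IsVertexConnected B 3 →
        Nat.card V ≡ 2 [MOD 4] → g ≤ B.girth →
        ∀ u v a b c d : V, B.Adj u v →
          B.neighborSet u = {v, a, b} → B.neighborSet v = {u, c, d} →
          CubicGirth.IsCubic (CubicGirth.gluedGraph B u v a b c d) ∧
          CubicGirth.IsVertexConnected (CubicGirth.gluedGraph B u v a b c d) 3 ∧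
          4 ∣ Nat.card ((({u, v} : Set V)ᶜ : Set V) ⊕ (({u, v} : Set V)ᶜ : Set V)) ∧
          g ≤ (CubicGirth.gluedGraph B u v a b c d).girth) := by
  refine ⟨fun g _ => ?_, fun g hg V _ B hB h3 _ hgB u v a b c d huv hu hv =>
    CubicGirth.isCubic_isVertexConnected_dvd_card_le_girth_gluedGraph hg hB h3 hgB huv hu hv⟩
  -- The shift by 4 meets the girth requirement of the gluing; any edge of `B` can serve as the
  -- site.
  obtain ⟨V, _, B, hB, h3, hgB⟩ := CubicGirth.exists_cubic_isVertexConnected_three (g + 4)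
  have : Nonempty V := by
    by_contra hV
    rw [not_nonempty_iff] at hV
    exact absurd h3.1 (by simp [ENat.card_eq_zero_iff_empty _ |>.2 hV])
  obtain ⟨u⟩ := this
  have hN : ∀ x y, B.Adj x y → ∃ p q, B.neighborSet x = {y, p, q} := by
    intro x y hxy
    have h := CubicGirth.isCubic_iff_ncard.1 hB x
    have h2 : (B.neighborSet x \ {y}).ncard = 2 := by
      rw [Set.ncard_sdiff_singleton_of_mem ((B.mem_neighborSet x y).2 hxy), h]
    obtain ⟨p, q, -, hpq⟩ := Set.ncard_eq_two.1 h2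
    refine ⟨p, q, ?_⟩
    rw [← hpq, Set.insert_sdiff_singleton, Set.insert_eq_of_mem ((B.mem_neighborSet x y).2 hxy)]
  obtain ⟨v, huv⟩ : (B.neighborSet u).Nonempty :=
    Set.nonempty_of_ncard_ne_zero (by rw [CubicGirth.isCubic_iff_ncard.1 hB u]; norm_num)
  obtain ⟨a, b, hab⟩ := hN u v huv
  obtain ⟨c, d, hcd⟩ := hN v u huv.symm
  obtain ⟨h1, h2, h4, h5⟩ :=
    CubicGirth.isCubic_isVertexConnected_dvd_card_le_girth_gluedGraph (by omega) hB h3 hgB huv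
      hab hcd
  exact ⟨_, inferInstance, _, h1, h2, h4, le_trans (by omega) h5⟩
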